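/- For a group $G$ and a set $A$, let $\mathrm{CA}(G;A)$ be the monoid, under composition, of all cellular automata over $G$ and $A$, i.e. of all maps $\tau : A^G \to A^G$ for which there are a finite set $S \subseteq G$ and a function $\mu : A^S \to A$ with $\tau(x)(g) = \mu\big((x(sg))_{s \in S}\big)$ for all $x \in A^G$, $g \in G$. For a finite monoid $M$, let $\mathrm{Rank}(M)$ be the minimum cardinality of a subset of $M$ that generates $M$ as a monoid. The group $G$ acts on $A^G$ by $(x\cdot g)(h) = x(hg^{-1})$; let $G_x$ be the stabiliser of $x \in A^G$. For a subgroup $H \leq G$ with conjugacy class $[H]$, let $\alpha_{[H]}(G;A)$ be the number of $G$-orbits on $A^G$ that are contained in $\{x \in A^G : G_x \in [H]\}$. Let $\mathcal{E}_G$ be the set of pairs $([H],[K])$ of conjugacy classes of subgroups of $G$ such that $H \leq g^{-1}Kg$ for some $g \in G$ (pairs with $[H]=[K]$ included). Let $\delta$ be Kronecker's delta. Let $G$ be a finite abelian group with $\mathrm{Rank}(G) = m$, and let $A$ be a finite set of size $q \geq 2$. Let $H_1, H_2, \dots, H_r$ be the list of the different subgroups of $G$, with $H_1 = G$, and let $\alpha_i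 := \alpha_{[H_i]}(G;A)$. Then \[ \mathrm{Rank}(\mathrm{CA}(G;A)) \leq \sum_{i=2}^r m\alpha_i + 2r + |\mathcal{E}_G| - \delta(q,2) - \sum_{i=2}^r \big(3\delta(\alpha_i,1) + \delta(\alpha_i,2)\big) \leq \sum_{i=2}^r m\alpha_i + 2r + r^2 . \] -/

import Mathlib

namespace FiniteCA

/-- A cellular automaton over `G` and `A`: there are a finite memory set `S ⊆ G` and a local
function `μ : A^S → A` such that the value of `τ x` at `g` is `μ` applied to the restriction
to `S` of the configuration `h ↦ x (h * g)`. -/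
def IsCellularAutomaton {G A : Type*} [Group G] (τ : (G → A) → (G → A)) : Prop :=
  ∃ (S : Finset G) (μ : (S → A) → A), ∀ (x : G → A) (g : G), τ x g = μ (fun s => x (s * g))

theorem isCellularAutomaton_id {G A : Type*} [Group G] :
    IsCellularAutomaton (id : (G → A) → (G → A)) :=
  ⟨{1}, fun y => y ⟨1, by simp⟩, fun x g => by simp⟩

theorem IsCellularAutomaton.comp {G A : Type*} [Group G] {τ σ : (G → A) → (G → A)}
    (hτ : IsCellularAutomaton τ) (hσ : IsCellularAutomaton σ) : IsCellularAutomaton (τ ∘ σ) := by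
  classical
  obtain ⟨T, μ, hμ⟩ := hτ
  obtain ⟨S, ν, hν⟩ := hσ
  refine ⟨Finset.image₂ (fun s t => s * t) S T,
    fun y => μ (fun t => ν (fun s =>
      y ⟨s.1 * t.1, Finset.mem_image₂_of_mem s.2 t.2⟩)), fun x g => ?_⟩
  simp only [Function.comp_apply, hμ, hν, mul_assoc]

/-- The monoid `CA(G; A)` of all cellular automata over `G` and `A`, under composition, as a
submonoid of the monoid of all transformations of `A^G`. -/
def CA (G A : Type*) [Group G] : Submonoid (Function.End (G → A)) where
  carrier := {τ | IsCellularAutomaton (G := G) (A := A) τ}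
  one_mem' := isCellularAutomaton_id
  mul_mem' := fun hτ hσ => IsCellularAutomaton.comp hτ hσ

/-- The rank of a finite monoid: the minimum cardinality of a subset generating it as a monoid. -/
noncomputable def rank (M : Type*) [Monoid M] : ℕ :=
  sInf {n | ∃ T : Finset M, T.card = n ∧ Submonoid.closure (T : Set M) = ⊤}

/-- On a finite monoid the infimum defining the rank is attained. -/
theorem exists_card_eq_rank (M : Type*) [Monoid M] [Finite M] :
    ∃ T : Finset M, T.card = rank M ∧ Submonoid.closure (T : Set M) = ⊤ := by
  have := Fintype.ofFinite M
  exact Nat.sInf_mem (s := {n | ∃ T : Finset M, T.card = n ∧ Submonoid.closure (T : Set M) = ⊤})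
    ⟨_, Finset.univ, rfl, by simp⟩

/-- The right action of `G` on configurations: `(x · g)(h) = x (h * g⁻¹)`. -/
def shift {G A : Type*} [Group G] (x : G → A) (g : G) : G → A := fun h => x (h * g⁻¹)

theorem shift_one {G A : Type*} [Group G] (x : G → A) : shift x 1 = x := by
  funext h; simp [shift]

theorem shift_mul {G A : Type*} [Group G] (x : G → A) (a b : G) :
    shift x (a * b) = shift (shift x a) b := by
  funext h; simp [shift, mul_assoc]

/-- The orbit `xG` of a configuration. -/
def orbit {G A : Type*} [Group G] (x : G → A) : Set (G → A) := Set.range (shift x)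

/-- The set of all `G`-orbits on `A^G`. -/
def orbits (G A : Type*) [Group G] : Set (Set (G → A)) := Set.range orbit

/-- The stabiliser `G_x` of a configuration. -/
def stabiliser {G A : Type*} [Group G] (x : G → A) : Subgroup G where
  carrier := {g | shift x g = x}
  one_mem' := shift_one x
  mul_mem' := fun {a b} (ha : shift x a = x) (hb : shift x b = x) =>
    show shift x (a * b) = x by rw [shift_mul, ha, hb]
  inv_mem' := fun {a} (ha : shift x a = x) => show shift x a⁻¹ = x by
    conv_lhs => rw [← ha]
    rw [← shift_mul, mul_inv_cancel, shift_one]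

/-- The conjugate subgroup `g⁻¹ H g`. -/
def conjugate {G : Type*} [Group G] (H : Subgroup G) (g : G) : Subgroup G :=
  H.map (MulAut.conj g⁻¹).toMonoidHom

/-- The conjugacy class `[H]` of a subgroup. -/
def conjClass {G : Type*} [Group G] (H : Subgroup G) : Set (Subgroup G) :=
  Set.range (conjugate H)

/-- The set of configurations whose stabiliser lies in the conjugacy class `c`. -/
def block {G : Type*} (A : Type*) [Group G] (c : Set (Subgroup G)) : Set (G → A) :=
  {x | stabiliser x ∈ c}

/-- The number of `G`-orbits on `A^G` contained in the block of the conjugacy class `c`. -/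
noncomputable def alpha {G : Type*} (A : Type*) [Group G] (c : Set (Subgroup G)) : ℕ :=
  {O ∈ orbits G A | O ⊆ block A c}.ncard

/-- The edge set of the directed graph on conjugacy classes of subgroups: the pairs
`([H], [K])`, loops included, such that `H ≤ g⁻¹ K g` for some `g`. -/
def edges (G : Type*) [Group G] : Set (Set (Subgroup G) × Set (Subgroup G)) :=
  {p | ∃ H K : Subgroup G, p = (conjClass H, conjClass K) ∧ ∃ g : G, H ≤ conjugate K g}

/-- Kronecker's delta. -/
def delta (a b : ℕ) : ℤ := if a = b then 1 else 0

end FiniteCA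

namespace FiniteCA

open MulAction

/-! For finite abelian `G`, shifting makes `A^G` a left `G`-set, and cellular automata are exactly
its equivariant self-maps (`CA_eq_equivariantEnd`). Such a map is determined by its values on a
transversal of the orbits, and any values whose stabilisers contain those of the representatives are
allowed. Since `G` is abelian, conjugacy classes of subgroups are singletons and the stabiliser is
an invariant of the orbit.

Three kinds of elementary map generate (`equivariantEnd_le`): swaps of orbits with equal stabiliser,
rotations of one orbit, and collapses of one orbit onto another. They are produced by few generators
(`exists_closure_eq_equivariantEnd`): for each non-constant orbit, `m` rotations; for each subgroup
`K` with `α` orbits, generators of the symmetric group on these orbits, at most two, one if `α = 2`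
and none if `α = 1`; for each pair `H ≤ K`, a single collapse, all others being obtained from it by
conjugation. The loop at `K` needs no collapse when `α = 1`. Thus `α = 1` saves 2 + 1 = 3 and `α =
2` saves 1. For `K = G` the orbits are the `q` constant configurations, which have no rotations. -/

/-- The submonoid of `G`-equivariant self-maps of a `G`-set. -/
def equivariantEnd (G X : Type*) [Group G] [MulAction G X] : Submonoid (Function.End X) where
  carrier := {τ | ∀ (g : G) (x : X), τ (g • x) = g • τ x}
  one_mem' := fun _ _ => rfl
  mul_mem' := fun {a b} ha hb g x => by
    change a (b (g • x)) = g • a (b x)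
    rw [hb, ha]

/-! ### Equivariant maps prescribed on a transversal -/

/-- A family of points meeting every orbit exactly once. -/
structure IsTransversal (G : Type*) {X Z : Type*} [Group G] [MulAction G X] (rep : Z → X) :
    Prop where
  exists_smul : ∀ x, ∃ (z : Z) (g : G), g • rep z = x
  eq_of_smul : ∀ {g : G} {z z' : Z}, g • rep z = rep z' → z = z'

open Classical in
/-- The map sending `g • rep z` to `g • f z`; it is well defined as soon as the stabiliser of
`rep z` fixes `f z` for all `z`. -/
noncomputable def extend (G : Type*) {X Z : Type*} [Group G] [MulAction G X] (rep f : Z → X) :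
    Function.End X := fun x =>
  if h : ∃ p : G × Z, p.1 • rep p.2 = x then h.choose.1 • f h.choose.2 else x

section

variable {G X Z : Type*} [CommGroup G] [MulAction G X] {rep f : Z → X}

/-- Two expressions of the same point share the representative, and their group elements differ by
an element of its stabiliser, which fixes the prescribed value. -/
theorem extend_smul (h : IsTransversal G rep)
    (hf : ∀ z, stabilizer G (rep z) ≤ stabilizer G (f z)) (g : G) (z : Z) :
    extend G rep f (g • rep z) = g • f z := by
  have hex : ∃ p : G × Z, p.1 • rep p.2 = g • rep z := ⟨(g, z), rfl⟩
  unfold extend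
  rw [dif_pos hex]
  have hs := hex.choose_spec
  generalize hex.choose = p at hs ⊢
  obtain ⟨k, w⟩ := p
  dsimp only at hs ⊢
  have hs' : (g⁻¹ * k) • rep w = rep z := by rw [mul_smul, hs, inv_smul_smul]
  obtain rfl := h.eq_of_smul hs'
  have h2 : (g⁻¹ * k) • f w = f w := hf w hs'
  rw [mul_smul, inv_smul_eq_iff] at h2
  exact h2

theorem extend_rep (h : IsTransversal G rep)
    (hf : ∀ z, stabilizer G (rep z) ≤ stabilizer G (f z)) (z : Z) :
    extend G rep f (rep z) = f z := by
  simpa using extend_smul h hf 1 z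

theorem extend_mem (h : IsTransversal G rep)
    (hf : ∀ z, stabilizer G (rep z) ≤ stabilizer G (f z)) :
    extend G rep f ∈ equivariantEnd G X := by
  intro g x
  obtain ⟨z, k, rfl⟩ := h.exists_smul x
  rw [smul_smul, extend_smul h hf, extend_smul h hf, mul_smul]

theorem equivariantEnd_ext (h : IsTransversal G rep) {τ σ : Function.End X}
    (hτ : τ ∈ equivariantEnd G X) (hσ : σ ∈ equivariantEnd G X)
    (hh : ∀ z, τ (rep z) = σ (rep z)) : τ = σ := by
  funext x
  obtain ⟨z, k, rfl⟩ := h.exists_smul x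
  rw [hτ, hσ, hh]

theorem stabilizer_le_of_mem {τ : Function.End X} (hτ : τ ∈ equivariantEnd G X) (x : X) :
    stabilizer G x ≤ stabilizer G (τ x) := by
  intro g hg
  rw [mem_stabilizer_iff] at *
  rw [← hτ, hg]

/-- Commutativity of `G` makes the stabiliser an invariant of the orbit. -/
theorem stabilizer_smul_comm (g : G) (x : X) : stabilizer G (g • x) = stabilizer G x := by
  ext k
  rw [mem_stabilizer_iff, mem_stabilizer_iff, smul_comm, smul_left_cancel_iff]

theorem stabilizer_eq_comp_swap [DecidableEq Z] {z z' : Z}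
    (hz : stabilizer G (rep z) = stabilizer G (rep z')) (w : Z) :
    stabilizer G (rep w) = stabilizer G ((rep ∘ Equiv.swap z z') w) := by
  by_cases h1 : w = z
  · subst h1; simp [hz]
  by_cases h2 : w = z'
  · subst h2; simp [hz]
  simp [Equiv.swap_apply_of_ne_of_ne h1 h2]

theorem stabilizer_le_update [DecidableEq Z] {z : Z} {y : X}
    (hz : stabilizer G (rep z) ≤ stabilizer G y) (w : Z) :
    stabilizer G (rep w) ≤ stabilizer G (Function.update rep z y w) := by
  by_cases h1 : w = z
  · subst h1; simpa using hz
  · simp [h1]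

/-! ### Generation by swaps, rotations and collapses -/

/-- Swaps of two orbits with equal stabilisers, rotations of single orbits and collapses of one orbit
onto another generate all equivariant maps. -/
theorem equivariantEnd_le [DecidableEq Z] [Finite X] [Finite Z] (h : IsTransversal G rep)
    (N : Submonoid (Function.End X))
    (hswap : ∀ z z', stabilizer G (rep z) = stabilizer G (rep z') →
      extend G rep (rep ∘ Equiv.swap z z') ∈ N)
    (hrot : ∀ z (g : G), extend G rep (Function.update rep z (g • rep z)) ∈ N)
    (hcol : ∀ z y, stabilizer G (rep z) ≤ stabilizer G y → (∀ g : G, g • rep z ≠ y) →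
      extend G rep (Function.update rep z y) ∈ N) :
    equivariantEnd G X ≤ N := by
  intro τ hτ
  -- Induction on the number of representatives that are moved; each case splits off elementary
  -- factors and leaves a map moving fewer.
  induction hn : {z | τ (rep z) ≠ rep z}.ncard using Nat.strong_induction_on generalizing τ with
  | _ n ih =>
  subst hn
  by_cases hfix : ∀ z, τ (rep z) = rep z
  · rw [equivariantEnd_ext h hτ (one_mem _) hfix]
    exact one_mem _
  by_cases hsurj : Function.Surjective τ
  · have hinj : Function.Injective τ := Finite.injective_iff_surjective.mpr hsurj
    push Not at hfix
    obtain ⟨z, hz⟩ := hfix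
    obtain ⟨z', g, hg⟩ := h.exists_smul (τ (rep z))
    have hst : stabilizer G (rep z) = stabilizer G (rep z') := by
      refine le_antisymm ?_ ?_
      · have := stabilizer_le_of_mem hτ (rep z)
        rwa [← hg, stabilizer_smul_comm] at this
      · intro k hk
        rw [← stabilizer_smul_comm g, hg, mem_stabilizer_iff, ← hτ] at hk
        exact hinj hk
    have hS := fun w => (stabilizer_eq_comp_swap (rep := rep) hst w).le
    have hR : ∀ k : G, ∀ w, _ := fun k => stabilizer_le_update (G := G) (rep := rep) (z := z)
      (y := k • rep z) (stabilizer_smul_comm k _).ge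
    set s := extend G rep (rep ∘ Equiv.swap z z') with hs
    set ρ := fun k : G => extend G rep (Function.update rep z (k • rep z)) with hρ
    have hsE : s ∈ equivariantEnd G X := extend_mem h hS
    have hρE : ∀ k, ρ k ∈ equivariantEnd G X := fun k => extend_mem h (hR k)
    -- The swap brings `τ (rep z) = g • rep z'` back to the orbit of `rep z`, and the rotation by
    -- `g⁻¹` then returns it to `rep z` itself.
    set τ' : Function.End X := ρ g⁻¹ * (s * τ) with hτ'
    have hτ'E : τ' ∈ equivariantEnd G X := mul_mem (hρE _) (mul_mem hsE hτ)
    have happ : ∀ x, τ' x = ρ g⁻¹ (s (τ x)) := fun _ => rfl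
    have hkey : τ = s * (ρ g * τ') := by
      have h1 : s * s = 1 := by
        refine equivariantEnd_ext h (mul_mem hsE hsE) (one_mem _) fun w => ?_
        change s (s (rep w)) = rep w
        simp only [hs]
        rw [extend_rep h hS, Function.comp_apply, extend_rep h hS, Function.comp_apply,
          Equiv.swap_apply_self]
      have h2 : ρ g * ρ g⁻¹ = 1 := by
        refine equivariantEnd_ext h (mul_mem (hρE _) (hρE _)) (one_mem _) fun w => ?_
        change ρ g (ρ g⁻¹ (rep w)) = rep w
        simp only [hρ]
        rw [extend_rep h (hR _)]
        by_cases hw : w = z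
        · subst hw
          rw [Function.update_self, extend_smul h (hR _), Function.update_self, inv_smul_smul]
        · rw [Function.update_of_ne hw, extend_rep h (hR _), Function.update_of_ne hw]
      rw [hτ', ← mul_assoc (ρ g), h2, one_mul, ← mul_assoc, h1, one_mul]
    rw [hkey]
    refine mul_mem (hswap _ _ hst) (mul_mem (hrot _ _) (ih _ ?_ hτ'E rfl))
    refine Set.ncard_lt_ncard ?_ (Set.toFinite _)
    have hz0 : τ' (rep z) = rep z := by
      rw [happ, ← hg]
      simp only [hs, hρ]
      rw [extend_smul h hS, Function.comp_apply, Equiv.swap_apply_right, extend_smul h (hR _),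
        Function.update_self, smul_inv_smul]
    refine (Set.ssubset_iff_of_subset ?_).mpr ⟨z, hz, fun hh => hh hz0⟩
    refine fun w hw (hw' : τ (rep w) = rep w) => hw ?_
    by_cases hwz : w = z
    · rw [hwz, hz0]
    -- If `z'` were fixed, its orbit would be hit from two different orbits, against injectivity.
    have hwz' : w ≠ z' := by
      rintro rfl
      have : τ (g • rep w) = τ (rep z) := by rw [hτ, hw', hg]
      exact hwz (h.eq_of_smul (hinj this))
    rw [happ, hw']
    simp only [hs, hρ]
    rw [extend_rep h hS, Function.comp_apply, Equiv.swap_apply_of_ne_of_ne hwz hwz',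
      extend_rep h (hR _), Function.update_of_ne hwz]
  · unfold Function.Surjective at hsurj
    push Not at hsurj
    obtain ⟨x, hx⟩ := hsurj
    obtain ⟨z, g, rfl⟩ := h.exists_smul x
    have hx' : ∀ (k : G) y, k • rep z ≠ τ y := by
      intro k y hy
      refine hx ((g * k⁻¹) • y) ?_
      rw [hτ, ← hy, smul_smul, inv_mul_cancel_right]
    have hst := stabilizer_le_of_mem hτ (rep z)
    have hU := stabilizer_le_update hst
    have hU' : ∀ w, stabilizer G (rep w) ≤
        stabilizer G (Function.update (fun w => τ (rep w)) z (rep z) w) := by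
      intro w
      by_cases hw : w = z
      · subst hw; simp
      · simpa [hw] using stabilizer_le_of_mem hτ (rep w)
    -- The orbit of `rep z` misses the image of `τ`, so it can be kept fixed first and collapsed
    -- afterwards: the collapse disturbs no other value.
    have hkey : τ = extend G rep (Function.update rep z (τ (rep z))) *
        extend G rep (Function.update (fun w => τ (rep w)) z (rep z)) := by
      refine equivariantEnd_ext h hτ (mul_mem (extend_mem h hU) (extend_mem h hU')) fun w => ?_
      change _ = extend G rep _ (extend G rep _ (rep w))
      rw [extend_rep h hU']
      by_cases hw : w = z
      · subst hw
        rw [Function.update_self, extend_rep h hU, Function.update_self]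
      · rw [Function.update_of_ne hw]
        obtain ⟨v, k, hk⟩ := h.exists_smul (τ (rep w))
        have hv : v ≠ z := by
          rintro rfl
          exact hx' _ _ hk
        rw [← hk, extend_smul h hU, Function.update_of_ne hv]
    rw [hkey]
    refine mul_mem (hcol _ _ hst fun k => hx' k _) (ih _ ?_ (extend_mem h hU') rfl)
    refine Set.ncard_lt_ncard ?_ (Set.toFinite _)
    have hz0 : extend G rep (Function.update (fun w => τ (rep w)) z (rep z)) (rep z) = rep z := by
      rw [extend_rep h hU', Function.update_self]
    refine (Set.ssubset_iff_of_subset ?_).mpr ⟨z, fun (hh : τ (rep z) = rep z) =>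
      hx' 1 (rep z) (by rw [one_smul, hh]), fun hh => hh hz0⟩
    refine fun w hw (hw' : τ (rep w) = rep w) => hw ?_
    by_cases hwz : w = z
    · rw [hwz, hz0]
    · rw [extend_rep h hU', Function.update_of_ne hwz, hw']

end

/-! ### Small generating sets of symmetric groups -/

theorem perm_fin_two_eq_one_or_swap : ∀ σ : Equiv.Perm (Fin 2), σ = 1 ∨ σ = Equiv.swap 0 1 := by decide

/-- A full cycle and an adjacent transposition suffice in general. On the empty type the bound is a
wasteful 2, which matches the stated formula when `α = 0`. -/
theorem exists_closure_perm_eq_top (α : Type*) [Finite α] :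
    ∃ T : Finset (Equiv.Perm α), Submonoid.closure (T : Set (Equiv.Perm α)) = ⊤ ∧
      (T.card : ℤ) ≤ 2 - delta (Nat.card α) 2 - 2 * delta (Nat.card α) 1 := by
  classical
  obtain ⟨n, ⟨e⟩⟩ := Finite.exists_equiv_fin α
  suffices h : ∃ T : Finset (Equiv.Perm (Fin n)),
      Submonoid.closure (T : Set (Equiv.Perm (Fin n))) = ⊤ ∧
      (T.card : ℤ) ≤ 2 - delta n 2 - 2 * delta n 1 by
    obtain ⟨T, hT, hc⟩ := h
    let φ : Equiv.Perm (Fin n) ≃* Equiv.Perm α := e.symm.permCongrHom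
    refine ⟨T.image φ, ?_, ?_⟩
    · rw [Finset.coe_image]
      have := MonoidHom.map_mclosure φ.toMonoidHom (T : Set (Equiv.Perm (Fin n)))
      rw [hT] at this
      refine this.symm.trans ?_
      rw [← MonoidHom.mrange_eq_map]
      exact MonoidHom.mrange_eq_top.mpr φ.surjective
    · rw [Nat.card_congr e, Nat.card_fin]
      exact le_trans (by exact_mod_cast Finset.card_image_le) hc
  match n with
  | 0 => exact ⟨∅, by ext σ; simp [Subsingleton.elim σ 1], by simp [delta]⟩
  | 1 => exact ⟨∅, by ext σ; simp [Subsingleton.elim σ 1], by simp [delta]⟩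
  | 2 =>
    refine ⟨{Equiv.swap 0 1}, ?_, by simp [delta]⟩
    refine (Submonoid.eq_top_iff' _).mpr fun σ => ?_
    have : σ = 1 ∨ σ = Equiv.swap 0 1 := perm_fin_two_eq_one_or_swap σ
    rcases this with rfl | rfl
    · exact one_mem _
    · exact Submonoid.subset_closure (by simp)
  | n + 3 =>
    refine ⟨{finRotate (n + 3), Equiv.swap 0 (finRotate (n + 3) 0)}, ?_, ?_⟩
    -- In a finite group inverses are powers, so generation as a group and as a monoid agree.
    · rw [← Subgroup.closure_toSubmonoid_of_finite]
      have := Equiv.Perm.closure_cycle_adjacent_swap (σ := finRotate (n + 3))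
        isCycle_finRotate support_finRotate 0
      simpa using congrArg Subgroup.toSubmonoid this
    · have h : ({finRotate (n + 3), Equiv.swap 0 (finRotate (n + 3) 0)} :
        Finset (Equiv.Perm (Fin (n + 3)))).card ≤ 2 := Finset.card_le_two
      simpa [delta] using h

/-! ### Relations between elementary maps and the counted generating set -/

section

variable {G X Z : Type*} [CommGroup G] [MulAction G X] {rep f : Z → X}

theorem extend_comp_mul (h : IsTransversal G rep) {σ τ : Z → Z}
    (hσ : ∀ z, stabilizer G (rep z) ≤ stabilizer G (rep (σ z)))
    (hτ : ∀ z, stabilizer G (rep z) ≤ stabilizer G (rep (τ z))) :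
    extend G rep (rep ∘ (σ ∘ τ)) = extend G rep (rep ∘ σ) * extend G rep (rep ∘ τ) := by
  have hστ : ∀ z, stabilizer G (rep z) ≤ stabilizer G ((rep ∘ (σ ∘ τ)) z) :=
    fun z => (hτ z).trans (hσ _)
  have hσ' : ∀ z, stabilizer G (rep z) ≤ stabilizer G ((rep ∘ σ) z) := hσ
  have hτ' : ∀ z, stabilizer G (rep z) ≤ stabilizer G ((rep ∘ τ) z) := hτ
  refine equivariantEnd_ext h (extend_mem h hστ) (mul_mem (extend_mem h hσ') (extend_mem h hτ'))
    fun w => ?_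
  change _ = extend G rep _ (extend G rep _ (rep w))
  rw [extend_rep h hστ, extend_rep h hτ', Function.comp_apply, Function.comp_apply,
    Function.comp_apply, extend_rep h hσ', Function.comp_apply]

theorem extend_self (h : IsTransversal G rep) : extend G rep rep = 1 :=
  equivariantEnd_ext h (extend_mem h fun _ => le_rfl) (one_mem _)
    fun _ => extend_rep h (fun _ => le_rfl) _

theorem extend_update_smul_mul [DecidableEq Z] (h : IsTransversal G rep) (z : Z) (g k : G) :
    extend G rep (Function.update rep z ((g * k) • rep z)) =
      extend G rep (Function.update rep z (g • rep z)) *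
        extend G rep (Function.update rep z (k • rep z)) := by
  have hR : ∀ k : G, ∀ w, _ := fun k => stabilizer_le_update (G := G) (rep := rep) (z := z)
      (y := k • rep z) (stabilizer_smul_comm k _).ge
  refine equivariantEnd_ext h (extend_mem h (hR _))
    (mul_mem (extend_mem h (hR _)) (extend_mem h (hR _))) fun w => ?_
  change _ = extend G rep _ (extend G rep _ (rep w))
  rw [extend_rep h (hR _), extend_rep h (hR k)]
  by_cases hw : w = z
  · subst hw
    simp only [Function.update_self]
    rw [extend_smul h (hR _), Function.update_self, mul_comm, mul_smul]
  · simp only [Function.update_of_ne hw]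
    rw [extend_rep h (hR _), Function.update_of_ne hw]

/-- Composing a collapse of one orbit onto another with a rotation of the target orbit. -/
theorem extend_update_smul_eq [DecidableEq Z] (h : IsTransversal G rep) {z w : Z} (hzw : z ≠ w)
    (hst : stabilizer G (rep z) ≤ stabilizer G (rep w)) (g : G) :
    extend G rep (Function.update rep z (g • rep w)) =
      extend G rep (Function.update rep w (g • rep w)) *
        (extend G rep (Function.update rep z (rep w)) *
          extend G rep (Function.update rep w (g⁻¹ • rep w))) := by
  have hR : ∀ k : G, ∀ v, _ := fun k => stabilizer_le_update (G := G) (rep := rep) (z := w)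
      (y := k • rep w) (stabilizer_smul_comm k _).ge
  have h1 := stabilizer_le_update hst
  have h2 := stabilizer_le_update (hst.trans (stabilizer_smul_comm g (rep w)).ge)
  refine equivariantEnd_ext h (extend_mem h h2)
    (mul_mem (extend_mem h (hR _)) (mul_mem (extend_mem h h1) (extend_mem h (hR _)))) fun v => ?_
  change _ = extend G rep _ (extend G rep _ (extend G rep _ (rep v)))
  rw [extend_rep h h2, extend_rep h (hR _)]
  by_cases hv : v = z
  · subst hv
    rw [Function.update_self, Function.update_of_ne hzw, extend_rep h h1, Function.update_self,
      extend_rep h (hR _), Function.update_self]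
  · rw [Function.update_of_ne hv]
    by_cases hvw : v = w
    · subst hvw
      rw [Function.update_self, extend_smul h h1, Function.update_of_ne hv, extend_smul h (hR _),
        Function.update_self, inv_smul_smul]
    · rw [Function.update_of_ne hvw, extend_rep h h1, Function.update_of_ne hv,
        extend_rep h (hR _), Function.update_of_ne hvw]

/-- Conjugating a collapse by a permutation of the orbits. -/
theorem extend_update_perm_eq [DecidableEq Z] (h : IsTransversal G rep) {z w : Z} (σ : Equiv.Perm Z)
    (hσ : ∀ v, stabilizer G (rep v) = stabilizer G (rep (σ v)))
    (hst : stabilizer G (rep z) ≤ stabilizer G (rep w)) :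
    extend G rep (Function.update rep (σ z) (rep (σ w))) =
      extend G rep (rep ∘ σ) *
        (extend G rep (Function.update rep z (rep w)) * extend G rep (rep ∘ σ.symm)) := by
  have h1 := stabilizer_le_update hst
  have h2 : ∀ v, stabilizer G (rep v) ≤
      stabilizer G (Function.update rep (σ z) (rep (σ w)) v) :=
    stabilizer_le_update (by rw [← hσ, ← hσ]; exact hst)
  have h3 : ∀ v, stabilizer G (rep v) ≤ stabilizer G ((rep ∘ σ) v) := fun v => (hσ v).le
  have h4 : ∀ v, stabilizer G (rep v) ≤ stabilizer G ((rep ∘ σ.symm) v) := fun v => by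
    rw [Function.comp_apply, hσ (σ.symm v), Equiv.apply_symm_apply]
  refine equivariantEnd_ext h (extend_mem h h2)
    (mul_mem (extend_mem h h3) (mul_mem (extend_mem h h1) (extend_mem h h4))) fun v => ?_
  change _ = extend G rep _ (extend G rep _ (extend G rep _ (rep v)))
  rw [extend_rep h h2, extend_rep h h4, Function.comp_apply, extend_rep h h1]
  obtain ⟨u, rfl⟩ := σ.surjective v
  rw [Equiv.symm_apply_apply]
  by_cases hv : u = z
  · subst hv
    rw [Function.update_self, Function.update_self, extend_rep h h3, Function.comp_apply]
  · rw [Function.update_of_ne hv, Function.update_of_ne (σ.injective.ne hv), extend_rep h h3,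
      Function.comp_apply]

open Classical in
/-- A map collapsing one orbit with stabiliser `p.1` onto a different orbit with stabiliser `p.2`,
or the identity if there are no such orbits. -/
noncomputable def collapse (rep : Z → X) (p : Subgroup G × Subgroup G) : Function.End X :=
  if h : ∃ v : Z × Z, v.1 ≠ v.2 ∧ stabilizer G (rep v.1) = p.1 ∧ stabilizer G (rep v.2) = p.2
  then extend G rep (Function.update rep h.choose.1 (rep h.choose.2)) else 1

theorem exists_closure_eq_equivariantEnd [Finite G] [Finite X] [Finite Z]
    [Fintype (Subgroup G)] (h : IsTransversal G rep) (TG : Finset G)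
    (hTG : Submonoid.closure (TG : Set G) = ⊤) :
    ∃ T : Finset (Function.End X), Submonoid.closure (T : Set (Function.End X)) =
        equivariantEnd G X ∧
      (T.card : ℤ) ≤ Nat.card {z // stabilizer G (rep z) ≠ ⊤} * TG.card
        + ∑ K : Subgroup G, (2 - delta (Nat.card {z // stabilizer G (rep z) = K}) 2
          - 2 * delta (Nat.card {z // stabilizer G (rep z) = K}) 1)
        + {p : Subgroup G × Subgroup G | p.1 ≤ p.2}.ncard
        - ∑ K : Subgroup G, delta (Nat.card {z // stabilizer G (rep z) = K}) 1 := by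
  classical
  have := Fintype.ofFinite Z
  choose P hP hPc using fun K : Subgroup G =>
    exists_closure_perm_eq_top {z // stabilizer G (rep z) = K}
  let T₁ : Finset (Function.End X) :=
    ((Finset.univ.filter fun z => stabilizer G (rep z) ≠ ⊤) ×ˢ TG).image
      fun p => extend G rep (Function.update rep p.1 (p.2 • rep p.1))
  let T₂ : Finset (Function.End X) := Finset.univ.biUnion fun K =>
    (P K).image fun σ => extend G rep (rep ∘ Equiv.Perm.ofSubtype σ)
  let E : Finset (Subgroup G × Subgroup G) := Finset.univ.filter fun p => p.1 ≤ p.2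
  -- Loops at subgroups with exactly one orbit: there is no second orbit to collapse onto.
  let D : Finset (Subgroup G × Subgroup G) := (Finset.univ.filter fun K : Subgroup G =>
    Nat.card {z // stabilizer G (rep z) = K} = 1).image fun K => (K, K)
  let T₃ : Finset (Function.End X) := (E \ D).image (collapse rep)
  have hperm : ∀ (K : Subgroup G) (σ : Equiv.Perm {z // stabilizer G (rep z) = K}) (v : Z),
      stabilizer G (rep v) = stabilizer G (rep (Equiv.Perm.ofSubtype σ v)) := by
    intro K σ v
    by_cases hv : stabilizer G (rep v) = K
    · rw [Equiv.Perm.ofSubtype_apply_of_mem σ hv, (σ ⟨v, hv⟩).2, hv]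
    · rw [Equiv.Perm.ofSubtype_apply_of_not_mem σ hv]
  have hR : ∀ (z : Z) (k : G) (w : Z), _ := fun z k => stabilizer_le_update (G := G) (rep := rep)
    (z := z) (y := k • rep z) (stabilizer_smul_comm k _).ge
  refine ⟨T₁ ∪ T₂ ∪ T₃, le_antisymm ?_ ?_, ?_⟩
  · rw [Submonoid.closure_le]
    intro τ hτ
    simp only [Finset.coe_union, Set.mem_union, Finset.mem_coe] at hτ
    rcases hτ with (hτ | hτ) | hτ
    · obtain ⟨p, -, rfl⟩ := Finset.mem_image.mp hτ
      exact extend_mem h (hR _ _)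
    · obtain ⟨K, -, hτ⟩ := Finset.mem_biUnion.mp hτ
      obtain ⟨σ, -, rfl⟩ := Finset.mem_image.mp hτ
      exact extend_mem h fun v => (hperm K σ v).le
    · obtain ⟨p, hp, rfl⟩ := Finset.mem_image.mp hτ
      unfold collapse
      split_ifs with hex
      · refine extend_mem h (stabilizer_le_update ?_)
        rw [hex.choose_spec.2.1, hex.choose_spec.2.2]
        exact (Finset.mem_filter.mp (Finset.mem_sdiff.mp hp).1).2
      · exact one_mem _
  · set N := Submonoid.closure ((T₁ ∪ T₂ ∪ T₃ : Finset (Function.End X)) : Set (Function.End X))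
      with hN
    have hsub : ∀ τ ∈ T₁ ∪ T₂ ∪ T₃, τ ∈ N := fun τ hτ => Submonoid.subset_closure hτ
    have hswap : ∀ z z', stabilizer G (rep z) = stabilizer G (rep z') →
        extend G rep (rep ∘ Equiv.swap z z') ∈ N := by
      intro z z' hz
      set K := stabilizer G (rep z') with hK
      have hall : ∀ σ : Equiv.Perm {z // stabilizer G (rep z) = K},
          extend G rep (rep ∘ Equiv.Perm.ofSubtype σ) ∈ N := by
        intro σ
        have hσ : σ ∈ Submonoid.closure (P K : Set _) := by rw [hP]; trivial
        induction hσ using Submonoid.closure_induction with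
        | mem σ hσ =>
          refine hsub _ (Finset.mem_union_left _ (Finset.mem_union_right _ ?_))
          exact Finset.mem_biUnion.mpr ⟨K, Finset.mem_univ _, Finset.mem_image_of_mem _ hσ⟩
        | one =>
          rw [map_one, Equiv.Perm.coe_one, Function.comp_id, extend_self h]
          exact one_mem _
        | mul σ τ _ _ hσ hτ =>
          rw [map_mul, Equiv.Perm.coe_mul, extend_comp_mul h (fun v => (hperm K σ v).le)
            (fun v => (hperm K τ v).le)]
          exact mul_mem hσ hτ
      have := hall (Equiv.swap ⟨z, hz⟩ ⟨z', rfl⟩)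
      rwa [Equiv.Perm.ofSubtype_swap_eq] at this
    have hrot : ∀ z (g : G), extend G rep (Function.update rep z (g • rep z)) ∈ N := by
      intro z g
      -- Rotations of one-point orbits are trivial, so `T₁` may omit them.
      by_cases hz : stabilizer G (rep z) = ⊤
      · have hg : g • rep z = rep z := by
          rw [← mem_stabilizer_iff, hz]; trivial
        rw [hg, Function.update_eq_self, extend_self h]
        exact one_mem _
      have hg : g ∈ Submonoid.closure (TG : Set G) := by rw [hTG]; trivial
      induction hg using Submonoid.closure_induction with
      | mem g hg =>
        refine hsub _ (Finset.mem_union_left _ (Finset.mem_union_left _ ?_))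
        refine Finset.mem_image.mpr ⟨(z, g), Finset.mem_product.mpr ⟨?_, hg⟩, rfl⟩
        exact Finset.mem_filter.mpr ⟨Finset.mem_univ _, hz⟩
      | one =>
        rw [one_smul, Function.update_eq_self, extend_self h]
        exact one_mem _
      | mul g k _ _ hg hk =>
        rw [extend_update_smul_mul h]
        exact mul_mem hg hk
    refine equivariantEnd_le h N hswap hrot fun z y hzy hy => ?_
    obtain ⟨w, g, rfl⟩ := h.exists_smul y
    rw [stabilizer_smul_comm] at hzy
    have hzw : z ≠ w := by
      rintro rfl
      exact hy g rfl
    -- Rotations reduce an arbitrary target to a representative; it remains to reach the collapse of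
    -- `z` onto `w` from the chosen one.
    rw [extend_update_smul_eq h hzw hzy]
    refine mul_mem (hrot _ _) (mul_mem ?_ (hrot _ _))
    have hc : collapse rep (stabilizer G (rep z), stabilizer G (rep w)) ∈ N := by
      refine hsub _ (Finset.mem_union_right _ (Finset.mem_image_of_mem _ ?_))
      refine Finset.mem_sdiff.mpr ⟨Finset.mem_filter.mpr ⟨Finset.mem_univ _, hzy⟩, fun hD => ?_⟩
      obtain ⟨K, hK, hKe⟩ := Finset.mem_image.mp hD
      have hK1 := (Finset.mem_filter.mp hK).2
      rw [Nat.card_eq_one_iff_unique] at hK1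
      obtain ⟨h1, h2⟩ := Prod.mk.inj hKe
      have := hK1.1.elim ⟨z, h1.symm⟩ ⟨w, h2.symm⟩
      exact hzw (congrArg Subtype.val this)
    have hex : ∃ v : Z × Z, v.1 ≠ v.2 ∧ stabilizer G (rep v.1) = stabilizer G (rep z) ∧
        stabilizer G (rep v.2) = stabilizer G (rep w) := ⟨(z, w), hzw, rfl, rfl⟩
    unfold collapse at hc
    rw [dif_pos hex] at hc
    have hs := hex.choose_spec
    generalize hex.choose = p at hs hc
    obtain ⟨z₀, w₀⟩ := p
    obtain ⟨hne, hz₀, hw₀⟩ := hs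
    dsimp only at hne hz₀ hw₀ hc
    have hs1 := stabilizer_eq_comp_swap (rep := rep) hz₀
    have hw' : stabilizer G (rep (Equiv.swap z₀ z w₀)) = stabilizer G (rep w) := by
      rw [← hw₀]; exact (hs1 w₀).symm
    have hs2 := stabilizer_eq_comp_swap (rep := rep) hw'
    -- `σ` carries `(z₀, w₀)` to `(z, w)` within the stabiliser classes: the first swap places `z₀`,
    -- the second moves the image of `w₀` to `w` without touching `z`.
    set σ : Equiv.Perm Z := Equiv.swap (Equiv.swap z₀ z w₀) w * Equiv.swap z₀ z with hσ
    have hσz : σ z₀ = z := by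
      rw [hσ, Equiv.Perm.mul_apply, Equiv.swap_apply_left, Equiv.swap_apply_of_ne_of_ne _ hzw]
      intro hh
      have : Equiv.swap z₀ z z₀ = Equiv.swap z₀ z w₀ := by rw [Equiv.swap_apply_left]; exact hh
      exact hne ((Equiv.swap z₀ z).injective this)
    have hσw : σ w₀ = w := by
      rw [hσ, Equiv.Perm.mul_apply, Equiv.swap_apply_left]
    have hσs : ∀ v, stabilizer G (rep v) = stabilizer G (rep (σ v)) := fun v =>
      (hs1 v).trans (hs2 _)
    have hkey := extend_update_perm_eq h (z := z₀) (w := w₀) σ hσs (by rw [hz₀, hw₀]; exact hzy)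
    rw [hσz, hσw] at hkey
    rw [hkey]
    refine mul_mem ?_ (mul_mem hc ?_)
    · rw [hσ, Equiv.Perm.coe_mul, extend_comp_mul h (fun v => (hs2 v).le) (fun v => (hs1 v).le)]
      exact mul_mem (hswap _ _ hw') (hswap _ _ hz₀)
    · have : σ.symm = Equiv.swap z₀ z * Equiv.swap (Equiv.swap z₀ z w₀) w := by
        change σ⁻¹ = _
        rw [hσ, mul_inv_rev, Equiv.swap_inv, Equiv.swap_inv]
      rw [this, Equiv.Perm.coe_mul, extend_comp_mul h (fun v => (hs1 v).le) (fun v => (hs2 v).le)]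
      exact mul_mem (hswap _ _ hz₀) (hswap _ _ hw')
  · have c1 : (T₁.card : ℤ) ≤ Nat.card {z // stabilizer G (rep z) ≠ ⊤} * TG.card := by
      have : T₁.card ≤ _ := Finset.card_image_le
      rw [Finset.card_product] at this
      rw [Nat.card_eq_fintype_card, Fintype.card_subtype]
      exact_mod_cast this
    have c2 : (T₂.card : ℤ) ≤
        ∑ K : Subgroup G, (2 - delta (Nat.card {z // stabilizer G (rep z) = K}) 2
          - 2 * delta (Nat.card {z // stabilizer G (rep z) = K}) 1) := by
      have : T₂.card ≤ ∑ K : Subgroup G, (P K).card :=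
        Finset.card_biUnion_le.trans (Finset.sum_le_sum fun K _ => Finset.card_image_le)
      have h' : (T₂.card : ℤ) ≤ ∑ K : Subgroup G, ((P K).card : ℤ) := by exact_mod_cast this
      exact h'.trans <| Finset.sum_le_sum fun K _ => hPc K
    have c3 : (T₃.card : ℤ) ≤ {p : Subgroup G × Subgroup G | p.1 ≤ p.2}.ncard
        - ∑ K : Subgroup G, delta (Nat.card {z // stabilizer G (rep z) = K}) 1 := by
      have hDE : D ⊆ E := by
        intro p hp
        obtain ⟨K, -, rfl⟩ := Finset.mem_image.mp hp
        exact Finset.mem_filter.mpr ⟨Finset.mem_univ _, le_rfl⟩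
      have hle : T₃.card ≤ (E \ D).card := Finset.card_image_le
      have hDc : (D.card : ℤ) =
          ∑ K : Subgroup G, delta (Nat.card {z // stabilizer G (rep z) = K}) 1 := by
        rw [Finset.card_image_of_injective _ fun a b hab => (Prod.mk.inj hab).1,
          Finset.card_filter]
        simp [delta]
      have hEc : {p : Subgroup G × Subgroup G | p.1 ≤ p.2}.ncard = E.card := by
        rw [← Set.ncard_coe_finset]
        simp [E]
      have := Finset.card_sdiff_add_card_eq_card hDE
      rw [hEc, ← hDc]
      omega
    have c4 : (T₁ ∪ T₂ ∪ T₃).card ≤ T₁.card + T₂.card + T₃.card :=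
      (Finset.card_union_le _ _).trans (Nat.add_le_add_right (Finset.card_union_le _ _) _)
    omega

end

/-! ### From equivariant maps to cellular automata -/

theorem rank_le_card {M : Type*} [Monoid M] {S : Submonoid M} {T : Finset M}
    (h : Submonoid.closure (T : Set M) = S) : rank S ≤ T.card := by
  classical
  subst h
  have hinj := Subtype.val_injective (p := fun x => x ∈ Submonoid.closure (T : Set M))
  have hT : Submonoid.closure ((T.preimage Subtype.val hinj.injOn : Finset _) :
      Set (Submonoid.closure (T : Set M))) = ⊤ := by
    rw [Finset.coe_preimage]
    exact Submonoid.closure_closure_coe_preimage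
  refine le_trans (Nat.sInf_le ⟨_, rfl, hT⟩) ?_
  exact Finset.card_le_card_of_injOn Subtype.val (fun x hx => Finset.mem_preimage.mp hx)
    hinj.injOn

/-- The shift action of an abelian group on configurations. -/
@[reducible]
def shiftAction (G A : Type*) [CommGroup G] : MulAction G (G → A) where
  smul g x := shift x g
  one_smul := shift_one
  mul_smul g k x := by
    change shift x (g * k) = shift (shift x k) g
    -- Commutativity turns the right action into a left one.
    rw [mul_comm, shift_mul]

section

variable {G A : Type*} [CommGroup G]

theorem CA_eq_equivariantEnd [Finite G] :
    letI := shiftAction G A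
    CA G A = equivariantEnd G (G → A) := by
  have := Fintype.ofFinite G
  let := shiftAction G A
  ext τ
  constructor
  · rintro ⟨S, μ, hμ⟩ g x
    change τ (shift x g) = shift (τ x) g
    funext k
    rw [hμ]
    simp only [shift]
    rw [hμ]
    simp only [mul_assoc]
  · intro hτ
    -- Finiteness of `G` allows all of `G` as memory set; the local rule reads `τ` at the identity,
    -- and equivariance transports it to every `g`.
    refine ⟨Finset.univ, fun y => τ (fun k => y ⟨k, Finset.mem_univ k⟩) 1, fun x g => ?_⟩
    have h : τ (shift x g⁻¹) = shift (τ x) g⁻¹ := hτ g⁻¹ x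
    have h1 := congrFun h 1
    simp only [shift, inv_inv, one_mul] at h1
    change τ x g = τ (fun k => x (k * g)) 1
    rw [← h1]
    refine congrArg (fun y => τ y 1) (funext fun k => ?_)
    simp [shift]

theorem mem_orbit_self (x : G → A) : x ∈ orbit x := ⟨1, shift_one x⟩

theorem orbit_shift (x : G → A) (g : G) : orbit (shift x g) = orbit x := by
  ext y
  constructor
  · rintro ⟨k, rfl⟩
    exact ⟨g * k, shift_mul x g k⟩
  · rintro ⟨k, rfl⟩
    exact ⟨g⁻¹ * k, by rw [← shift_mul, mul_inv_cancel_left]⟩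

theorem stabiliser_shift (x : G → A) (g : G) : stabiliser (shift x g) = stabiliser x := by
  let := shiftAction G A
  exact stabilizer_smul_comm (X := G → A) g x

/-- A chosen point of an orbit. -/
noncomputable def orbitRep (z : orbits G A) : G → A := z.2.choose

theorem orbit_orbitRep (z : orbits G A) : orbit (orbitRep z) = z := z.2.choose_spec

theorem isTransversal_orbitRep :
    letI := shiftAction G A
    IsTransversal G (orbitRep : orbits G A → G → A) := by
  let := shiftAction G A
  refine ⟨fun x => ?_, fun {g z z'} hz => ?_⟩
  · refine ⟨⟨orbit x, x, rfl⟩, ?_⟩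
    have h : x ∈ orbit (orbitRep ⟨orbit x, x, rfl⟩) := by
      rw [orbit_orbitRep]; exact mem_orbit_self x
    exact h
  · have hz' : shift (orbitRep z) g = orbitRep z' := hz
    refine Subtype.ext ?_
    rw [← orbit_orbitRep z, ← orbit_orbitRep z', ← hz', orbit_shift]

theorem conjClass_eq_singleton (H : Subgroup G) : conjClass H = {H} := by
  have h : ∀ g : G, conjugate H g = H := by
    intro g
    ext k
    simp [conjugate, Subgroup.mem_map]
  ext K
  simp [conjClass, h, eq_comm]

theorem alpha_eq_card (K : Subgroup G) :
    alpha A (conjClass K) = Nat.card {z : orbits G A // stabiliser (orbitRep z) = K} := by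
  have h : ∀ z : orbits G A, (z : Set (G → A)) ⊆ block A (conjClass K) ↔
      stabiliser (orbitRep z) = K := by
    intro z
    rw [conjClass_eq_singleton, ← orbit_orbitRep z]
    constructor
    · intro hz
      have := hz (mem_orbit_self (orbitRep z))
      exact this
    · rintro hz _ ⟨g, rfl⟩
      change stabiliser _ = K
      rw [stabiliser_shift, hz]
  unfold alpha
  rw [← Nat.card_coe_set_eq]
  exact Nat.card_congr
    ⟨fun O => ⟨⟨O, O.2.1⟩, (h ⟨O, O.2.1⟩).mp O.2.2⟩, fun z => ⟨z.1.1, z.1.2, (h z.1).mpr z.2⟩,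
      fun _ => rfl, fun _ => rfl⟩

/-- The configurations fixed by all of `G` are the constant ones, each an orbit by itself. -/
theorem alpha_top : alpha A (conjClass (⊤ : Subgroup G)) = Nat.card A := by
  have hconst : ∀ a : A, orbit (fun _ : G => a) = {fun _ => a} := by
    intro a
    exact Set.range_const (ι := G)
  have hset : {O ∈ orbits G A | O ⊆ block A (conjClass (⊤ : Subgroup G))} =
      Set.range fun a : A => ({fun _ => a} : Set (G → A)) := by
    ext O
    rw [conjClass_eq_singleton]
    constructor
    · rintro ⟨⟨x, rfl⟩, hO⟩
      have hx : stabiliser x = ⊤ := hO (mem_orbit_self x)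
      refine ⟨x 1, ?_⟩
      dsimp only
      rw [← hconst]
      congr 1
      funext g
      have hg : g ∈ stabiliser x := by rw [hx]; trivial
      have hg' : shift x g = x := hg
      simpa [shift] using congrFun hg' g
    · rintro ⟨a, rfl⟩
      refine ⟨⟨fun _ => a, hconst a⟩, ?_⟩
      rintro _ rfl
      refine (Subgroup.eq_top_iff' _).mpr fun g => ?_
      rfl
  have hinj : Function.Injective fun a : A => ({fun _ => a} : Set (G → A)) := fun a b hab =>
    congrFun (Set.singleton_injective hab) 1
  unfold alpha
  rw [hset, ← Nat.card_coe_set_eq]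
  exact (Nat.card_congr (Equiv.ofInjective _ hinj)).symm

theorem ncard_edges : (edges G).ncard = {p : Subgroup G × Subgroup G | p.1 ≤ p.2}.ncard := by
  have h : ∀ (H : Subgroup G) (g : G), conjugate H g = H := fun H g => by
    have : conjugate H g ∈ conjClass H := ⟨g, rfl⟩
    rwa [conjClass_eq_singleton] at this
  have hset : edges G = (fun p : Subgroup G × Subgroup G => (({p.1}, {p.2}) :
      Set (Subgroup G) × Set (Subgroup G))) '' {p | p.1 ≤ p.2} := by
    ext p
    simp only [edges, conjClass_eq_singleton, h, exists_const]
    constructor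
    · rintro ⟨H, K, rfl, hHK⟩
      exact ⟨(H, K), hHK, rfl⟩
    · rintro ⟨⟨H, K⟩, hHK, rfl⟩
      exact ⟨H, K, rfl, hHK⟩
  rw [hset, Set.ncard_image_of_injective]
  rintro ⟨a, b⟩ ⟨c, d⟩ hp
  simpa using hp

theorem rank_CA_le [Finite G] [Finite A] [Fintype (Subgroup G)] :
    (rank (CA G A) : ℤ) ≤ ((∑ K : Subgroup G, (alpha A (conjClass K) : ℤ)) - Nat.card A) * rank G
      + ∑ K : Subgroup G, (2 - delta (alpha A (conjClass K)) 2
          - 2 * delta (alpha A (conjClass K)) 1)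
      + (edges G).ncard - ∑ K : Subgroup G, delta (alpha A (conjClass K)) 1 := by
  classical
  let := shiftAction G A
  have := Fintype.ofFinite (orbits G A)
  obtain ⟨TG, hTc, hTG⟩ := exists_card_eq_rank G
  obtain ⟨T, hT, hc⟩ := exists_closure_eq_equivariantEnd
    (isTransversal_orbitRep (G := G) (A := A)) TG hTG
  have hα : ∀ K : Subgroup G, Nat.card {z : orbits G A // stabilizer G (orbitRep z) = K} =
    alpha A (conjClass K) := fun K => (alpha_eq_card K).symm
  -- Both sides count all orbits, the right side according to the stabiliser.
  have htop : Nat.card {z : orbits G A // stabilizer G (orbitRep z) ≠ ⊤} + Nat.card A =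
      ∑ K : Subgroup G, alpha A (conjClass K) := by
    rw [← alpha_top (G := G) (A := A), ← hα]
    simp only [← hα, Nat.card_eq_fintype_card, Fintype.card_subtype]
    rw [add_comm, Finset.card_filter_add_card_filter_not]
    exact Finset.card_eq_sum_card_fiberwise fun _ _ => Finset.mem_coe.mpr (Finset.mem_univ _)
  have htop' : (Nat.card {z : orbits G A // stabilizer G (orbitRep z) ≠ ⊤} : ℤ) =
      (∑ K : Subgroup G, (alpha A (conjClass K) : ℤ)) - Nat.card A := by
    rw [eq_sub_iff_add_eq]
    exact_mod_cast htop
  simp only [hα] at hc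
  rw [htop', hTc, ← ncard_edges] at hc
  refine le_trans ?_ hc
  exact_mod_cast rank_le_card (hT.trans CA_eq_equivariantEnd.symm)

theorem delta_nonneg (a b : ℕ) : 0 ≤ delta a b := by
  unfold delta
  split_ifs <;> norm_num

end

end FiniteCA

/-! ### Arithmetic of the bound -/

theorem mainTheorem5 {G A : Type*} [CommGroup G] [Finite G] [Finite A]
    (m q r : ℕ) (hm : FiniteCA.rank G = m) (hq : Nat.card A = q) (hq2 : 2 ≤ q)
    (H : ℕ → Subgroup G) (hH : Set.BijOn H (Set.Icc 1 r) Set.univ) (hH1 : H 1 = ⊤)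
    (α : ℕ → ℕ) (hα : ∀ i ∈ Set.Icc 1 r, α i = FiniteCA.alpha A (FiniteCA.conjClass (H i))) :
    (FiniteCA.rank (FiniteCA.CA G A) : ℤ) ≤
        (∑ i ∈ Finset.Icc 2 r, (m : ℤ) * α i) + 2 * r + (FiniteCA.edges G).ncard
          - FiniteCA.delta q 2
          - ∑ i ∈ Finset.Icc 2 r, (3 * FiniteCA.delta (α i) 1 + FiniteCA.delta (α i) 2) ∧
      (∑ i ∈ Finset.Icc 2 r, (m : ℤ) * α i) + 2 * r + (FiniteCA.edges G).ncard
          - FiniteCA.delta q 2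
          - ∑ i ∈ Finset.Icc 2 r, (3 * FiniteCA.delta (α i) 1 + FiniteCA.delta (α i) 2) ≤
        (∑ i ∈ Finset.Icc 2 r, (m : ℤ) * α i) + 2 * r + (r : ℤ) ^ 2 := by
  classical
  have := Fintype.ofFinite (Subgroup G)
  have hr : 1 ≤ r := by
    obtain ⟨i, hi, -⟩ := hH.surjOn (Set.mem_univ ⊤)
    exact hi.1.trans hi.2
  -- The term of `H 1 = ⊤` is split off because its number of orbits is known to be `q`.
  have hsum : ∀ f : ℕ → ℤ, ∑ K : Subgroup G, f (FiniteCA.alpha A (FiniteCA.conjClass K)) =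
      f q + ∑ i ∈ Finset.Icc 2 r, f (α i) := by
    intro f
    have h1 : ∑ i ∈ Finset.Icc 1 r, f (α i) =
        ∑ K : Subgroup G, f (FiniteCA.alpha A (FiniteCA.conjClass K)) := by
      refine Finset.sum_nbij H (fun _ _ => Finset.mem_univ _) ?_ ?_ fun i hi => ?_
      · rw [Finset.coe_Icc]; exact hH.injOn
      · rw [Finset.coe_Icc, Finset.coe_univ]; exact hH.surjOn
      · rw [hα i (Finset.mem_Icc.mp hi)]
    rw [← h1, ← Finset.add_sum_Ioc_eq_sum_Icc hr, hα 1 ⟨le_rfl, hr⟩, hH1, FiniteCA.alpha_top, hq]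
    rfl
  have hcard : Fintype.card (Subgroup G) = r := by
    have h1 := hH.image_eq
    have h2 := hH.injOn.ncard_image
    rw [h1, Set.ncard_univ, Nat.card_eq_fintype_card, ← Finset.coe_Icc, Set.ncard_coe_finset,
      Nat.card_Icc] at h2
    omega
  constructor
  · have hb := FiniteCA.rank_CA_le (G := G) (A := A)
    rw [hsum (fun n => (n : ℤ)), hsum (fun n => 2 - FiniteCA.delta n 2 - 2 * FiniteCA.delta n 1),
      hsum (fun n => FiniteCA.delta n 1), hq, hm] at hb
    -- As `q ≥ 2`, the whole group only contributes the saving `δ(q,2)`.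
    have hq1 : FiniteCA.delta q 1 = 0 := if_neg (by omega)
    have h2 : ∑ i ∈ Finset.Icc 2 r, (2 : ℤ) = 2 * r - 2 := by
      rw [Finset.sum_const, Nat.card_Icc, nsmul_eq_mul]
      omega
    simp only [Finset.sum_sub_distrib, Finset.sum_add_distrib, ← Finset.mul_sum, h2, hq1] at hb ⊢
    linarith
  · have hE : (FiniteCA.edges G).ncard ≤ r ^ 2 := by
      rw [FiniteCA.ncard_edges]
      refine (Set.ncard_le_ncard (Set.subset_univ _) (Set.toFinite _)).trans ?_
      rw [Set.ncard_univ, Nat.card_eq_fintype_card, Fintype.card_prod, hcard, sq]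
    have hE' : ((FiniteCA.edges G).ncard : ℤ) ≤ (r : ℤ) ^ 2 := by exact_mod_cast hE
    have h1 := FiniteCA.delta_nonneg q 2
    have h2 : 0 ≤ ∑ i ∈ Finset.Icc 2 r,
        (3 * FiniteCA.delta (α i) 1 + FiniteCA.delta (α i) 2) :=
      Finset.sum_nonneg fun i _ => by
        have := FiniteCA.delta_nonneg (α i) 1
        have := FiniteCA.delta_nonneg (α i) 2
        linarith
    linarith
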